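/- Let $\mathbb K\in\{\mathbb C,\mathbb R\}$. For $A\in M_n(\mathbb K)$ put $$\|A\|_{\ell_\infty\to\ell_1}=\sup\Big\{\Big|\tfrac1n\sum_{i,j}\overline{y_i}A_{ij}x_j\Big| : x,y\in\mathbb K^n,\ |x_i|,|y_i|\le 1\Big\},$$ $$\|A\|_G=\sup\Big\{\Big|\tfrac1n\sum_{i,j}A_{ij}\langle x_i,y_j\rangle\Big| : d\in\mathbb N,\ x_i,y_j\in\mathbb K^d,\ \|x_i\|,\|y_j\|\le 1\Big\},$$ and let $K_G^{\mathbb K}=\sup_{n,A}\|A\|_G/\|A\|_{\ell_\infty\to\ell_1}$ be the Grothendieck constant of $\mathbb K$, with $0/0$ read as $0$ (so $K_G=K_G^{\mathbb R}$; these suprema are finite by Grothendieck's inequality). Let $X$ be a compact space with a Borel probability measure $\nu$, let $C(X)$ be the space of continuous functions $X\to\mathbb K$, and let $\langle f,g\rangle=\int_X\overline f g\,d\nu$ and $\|f\|_{L_2}=\langle f,f\rangle^{1/2}$. For a bounded linear map $M:C(X)\to C(X)$ let $$\|M\|_{L_2\to L_2}=\sup\{|\langle g,Mf\rangle| : f,g\in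 C(X),\ \|f\|_{L_2},\|g\|_{L_2}\le 1\},\qquad \|M\|_{\mathrm{cut}}=\sup\{|\langle g,Mf\rangle| : f,g\in C(X)\text{ with values in }[0,1]\}.$$ Call $M$ transitive covariant if there is a compact Hausdorff group $\Gamma$ acting continuously and transitively on $X$, such that $\nu$ is the image of the Haar probability measure of $\Gamma$ under $\pi\mapsto\pi(s_0)$ (for every $s_0\in X$), and such that $(Mf^{\pi})^{\pi^{-1}}=Mf$ for all $\pi\in\Gamma$, $f\in C(X)$, where $f^{\pi}(s)=f(\pi(s))$. Let $S_{\mathbb K}^{m-1}$ be the unit sphere of $\mathbb K^m$ with its rotation-invariant (Haar) probability measure, let $[k]=\{1,\dots,k\}$ carry the uniform distribution, and give $S_{\mathbb K}^{m-1}\times[k]$ the product measure. **Theorem.** 1. (Complex case.) For every $\varepsilon>0$ there exist positive integers $m,k$ and a transitive covariant bounded linear map $M$ on $C(S_{\mathbb C}^{m-1}\times[k])$ (complex-valued functions) with $0<\|M\|_{\mathrm{cut}}$, $\|M\|_{L_2\to L_2}<\infty$ and $$\|M\|_{L_2\to L_2}\ \ge\ (\pi^2K_G^{\mathbb C}-\varepsilon)\,\|M\|_{\mathrm{cut}}.$$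 2. (Real case.) For every $\varepsilon>0$ there exist positive integers $m,k$ and a transitive covariant bounded linear map $M$ on $C(S_{\mathbb R}^{m-1}\times[k])$ (real-valued functions) with $0<\|M\|_{\mathrm{cut}}$, $\|M\|_{L_2\to L_2}<\infty$ and $$\|M\|_{L_2\to L_2}\ \ge\ (4K_G-\varepsilon)\,\|M\|_{\mathrm{cut}}.$$ In particular, the factor $\pi^2K_G^{\mathbb C}$ (complex case), respectively $4K_G$ (real case), in the inequality $\|M\|_{L_2\to L_2}\le C\,\|M\|_{\mathrm{cut}}$ for transitive covariant maps cannot be replaced by a smaller constant. -/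

import Mathlib

open MeasureTheory
open scoped ENNReal

namespace CutNorm

noncomputable section

/-! ### The Grothendieck constant of the field `𝕜` (real or complex) -/

/-- `‖A‖_{ℓ∞ → ℓ1} = sup { |⟨y, A x⟩| : ‖x‖_∞, ‖y‖_∞ ≤ 1 }`, where the inner product on `𝕜ⁿ` is
normalized, `⟨y, x⟩ = (1/n) ∑ i, conj (y i) * x i`. -/
def normInftyOne (𝕜 : Type) [RCLike 𝕜] {n : ℕ} (A : Matrix (Fin n) (Fin n) 𝕜) : ℝ :=
  sSup {r : ℝ | ∃ x y : Fin n → 𝕜, (∀ i, ‖x i‖ ≤ 1) ∧ (∀ i, ‖y i‖ ≤ 1) ∧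
    r = ‖(n : 𝕜)⁻¹ * ∑ i, star (y i) * A.mulVec x i‖}

/-- The Grothendieck norm
`‖A‖_G = sup { |(1/n) ∑ i j, A i j ⟨x i, y j⟩| : d ∈ ℕ, x i, y j in the unit ball of 𝕜ᵈ }`. -/
def grothendieckNorm (𝕜 : Type) [RCLike 𝕜] {n : ℕ} (A : Matrix (Fin n) (Fin n) 𝕜) : ℝ :=
  sSup {r : ℝ | ∃ (d : ℕ) (x y : Fin n → EuclideanSpace 𝕜 (Fin d)),
    (∀ i, ‖x i‖ ≤ 1) ∧ (∀ j, ‖y j‖ ≤ 1) ∧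
    r = ‖(n : 𝕜)⁻¹ * ∑ i, ∑ j, A i j * inner 𝕜 (x i) (y j)‖}

/-- The Grothendieck constant of `𝕜`: the supremum of `‖A‖_G / ‖A‖_{ℓ∞ → ℓ1}` over all square
matrices with entries in `𝕜` (the zero matrix contributes `0 / 0 = 0`).  This set of reals is
bounded, by the Grothendieck inequality. -/
def grothendieckConstant (𝕜 : Type) [RCLike 𝕜] : ℝ :=
  sSup {r : ℝ | ∃ (n : ℕ) (A : Matrix (Fin n) (Fin n) 𝕜),
    r = grothendieckNorm 𝕜 A / normInftyOne 𝕜 A}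

/-! ### Norms of linear maps on `C(X)`, with respect to a probability measure on `X` -/

section Norms

variable {𝕜 : Type} [RCLike 𝕜] {X : Type} [TopologicalSpace X] [MeasurableSpace X]

/-- `⟨f, g⟩ = ∫ conj f * g dν`. -/
def innerL2 (ν : Measure X) (f g : C(X, 𝕜)) : 𝕜 := ∫ x, star (f x) * g x ∂ν

/-- `‖f‖_{L2} = (∫ |f|² dν)^{1/2}`. -/
def normL2 (ν : Measure X) (f : C(X, 𝕜)) : ℝ := √(∫ x, ‖f x‖ ^ 2 ∂ν)

/-- `‖M‖_{L2 → L2} = sup { |⟨g, M f⟩| : ‖f‖_{L2}, ‖g‖_{L2} ≤ 1 }`, possibly infinite. -/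
def opNormL2 (ν : Measure X) (M : C(X, 𝕜) →L[𝕜] C(X, 𝕜)) : ℝ≥0∞ :=
  ⨆ (f : C(X, 𝕜)) (g : C(X, 𝕜)) (_ : normL2 ν f ≤ 1) (_ : normL2 ν g ≤ 1),
    ENNReal.ofReal ‖innerL2 ν g (M f)‖

/-- `f` takes its values in the real interval `[0, 1]`. -/
def UnitIntervalValued (f : C(X, 𝕜)) : Prop := ∀ x, ∃ t : ℝ, 0 ≤ t ∧ t ≤ 1 ∧ f x = (t : 𝕜)

/-- `‖M‖_cut = sup { |⟨g, M f⟩| : f, g continuous with values in [0, 1] }`. -/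
def cutNorm (ν : Measure X) (M : C(X, 𝕜) →L[𝕜] C(X, 𝕜)) : ℝ≥0∞ :=
  ⨆ (f : C(X, 𝕜)) (g : C(X, 𝕜)) (_ : UnitIntervalValued f) (_ : UnitIntervalValued g),
    ENNReal.ofReal ‖innerL2 ν g (M f)‖

end Norms

/-! ### Transitive covariance -/

/-- The Haar probability measure of a compact group. -/
def haarProb (Γ : Type) [Group Γ] [TopologicalSpace Γ] [IsTopologicalGroup Γ] [CompactSpace Γ]
    [MeasurableSpace Γ] [BorelSpace Γ] : Measure Γ :=
  Measure.haarMeasure (⊤ : TopologicalSpace.PositiveCompacts Γ)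

section Covariance

variable {𝕜 : Type} [RCLike 𝕜] {X : Type} [TopologicalSpace X]

/-- The function `f^π : s ↦ f (π s)`. -/
def translate {Γ : Type} [Group Γ] [TopologicalSpace Γ] [MulAction Γ X] [ContinuousSMul Γ X]
    (π : Γ) (f : C(X, 𝕜)) : C(X, 𝕜) :=
  ⟨fun s => f (π • s), f.continuous.comp (continuous_const_smul π)⟩

/-- `M` is transitive covariant: some compact group `Γ` acts continuously and transitively on `X`,
and `(M f^π)^{π⁻¹} = M f` for all `π ∈ Γ` and all `f`.  Since the norms of `M` are taken
with respect to `ν`, we also require that `ν` is the measure on `X` induced by `Γ`, that is, the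
image of the Haar probability measure of `Γ` under `π ↦ π s₀`, for every base point `s₀`. -/
def IsTransitiveCovariant [MeasurableSpace X] (ν : Measure X) (M : C(X, 𝕜) →L[𝕜] C(X, 𝕜)) :
    Prop :=
  ∃ (Γ : Type) (_ : Group Γ) (_ : TopologicalSpace Γ) (_ : IsTopologicalGroup Γ)
    (_ : CompactSpace Γ) (_ : T2Space Γ) (_ : MeasurableSpace Γ) (_ : BorelSpace Γ)
    (_ : MulAction Γ X) (_ : ContinuousSMul Γ X),
    MulAction.IsPretransitive Γ X ∧
    (∀ s₀ : X, Measure.map (fun π : Γ => π • s₀) (haarProb Γ) = ν) ∧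
    ∀ (π : Γ) (f : C(X, 𝕜)), translate π⁻¹ (M (translate π f)) = M f

end Covariance

/-! ### The sphere `S^{m-1}` in `𝕜ᵐ` and its Haar probability measure -/

section Sphere

variable (𝕜 : Type) [RCLike 𝕜] (m : ℕ)

/-- The unit sphere of `𝕜ᵐ`. -/
abbrev USphere : Type := Metric.sphere (0 : EuclideanSpace 𝕜 (Fin m)) 1

/-- The group of `m × m` unitary matrices over `𝕜` (orthogonal matrices if `𝕜 = ℝ`). -/
abbrev UGroup : Type := Matrix.unitaryGroup (Fin m) 𝕜

instance : MeasurableSpace (UGroup 𝕜 m) := borel _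

instance : BorelSpace (UGroup 𝕜 m) := ⟨rfl⟩

instance : CompactSpace (UGroup 𝕜 m) := by
  refine (isCompact_iff_compactSpace (s := ((Matrix.unitaryGroup (Fin m) 𝕜 :
    Submonoid (Matrix (Fin m) (Fin m) 𝕜)) : Set (Matrix (Fin m) (Fin m) 𝕜)))).1 ?_
  have hK : IsCompact (Set.univ.pi fun _ : Fin m => Set.univ.pi fun _ : Fin m =>
      Metric.closedBall (0 : 𝕜) 1) :=
    isCompact_univ_pi fun _ => isCompact_univ_pi fun _ => isCompact_closedBall 0 1
  have hc : IsClosed ((Matrix.unitaryGroup (Fin m) 𝕜 : Submonoid (Matrix (Fin m) (Fin m) 𝕜)) :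
      Set (Matrix (Fin m) (Fin m) 𝕜)) := by
    have h : ((Matrix.unitaryGroup (Fin m) 𝕜 : Submonoid (Matrix (Fin m) (Fin m) 𝕜)) :
        Set (Matrix (Fin m) (Fin m) 𝕜)) = {A | A * star A = 1} := by
      ext A
      exact Matrix.mem_unitaryGroup_iff
    rw [h]
    exact isClosed_eq (continuous_id.mul continuous_star) continuous_const
  refine IsCompact.of_isClosed_subset hK hc fun A hA => ?_
  intro i _ j _
  simpa using entry_norm_bound_of_unitary hA i j

variable {𝕜 m}

theorem norm_toLp_mulVec (U : UGroup 𝕜 m) (x : EuclideanSpace 𝕜 (Fin m)) :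
    ‖WithLp.toLp 2 (U.1.mulVec x.ofLp)‖ = ‖x‖ := by
  have h : U.1.conjTranspose * U.1 = 1 := Matrix.mem_unitaryGroup_iff'.1 U.2
  have h2 : inner 𝕜 (WithLp.toLp 2 (U.1.mulVec x.ofLp)) (WithLp.toLp 2 (U.1.mulVec x.ofLp)) =
      inner 𝕜 x x := by
    simp only [EuclideanSpace.inner_eq_star_dotProduct]
    rw [dotProduct_comm, Matrix.star_mulVec, ← Matrix.dotProduct_mulVec, Matrix.mulVec_mulVec, h,
      Matrix.one_mulVec, dotProduct_comm]
  rw [@norm_eq_sqrt_re_inner 𝕜, @norm_eq_sqrt_re_inner 𝕜 _ _ _ _ x, h2]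

/-- The unitary `U` applied to a point of the sphere. -/
def rotate (U : UGroup 𝕜 m) (x : USphere 𝕜 m) : USphere 𝕜 m :=
  ⟨WithLp.toLp 2 (U.1.mulVec x.1.ofLp), by
    rw [mem_sphere_zero_iff_norm, norm_toLp_mulVec]
    exact mem_sphere_zero_iff_norm.1 x.2⟩

variable (𝕜 m)

/-- The first standard basis vector, as a point of the sphere. -/
def basePoint [NeZero m] : USphere 𝕜 m :=
  ⟨EuclideanSpace.single 0 1, by simp⟩

/-- The Haar (that is, rotation invariant) probability measure on the sphere: the distribution of
`U e₁` for a Haar distributed unitary (orthogonal if `𝕜 = ℝ`) matrix `U`. -/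
def sphereMeasure [NeZero m] : Measure (USphere 𝕜 m) :=
  Measure.map (fun U : UGroup 𝕜 m => rotate U (basePoint 𝕜 m)) (haarProb (UGroup 𝕜 m))

/-- The product of the Haar probability measure of the sphere and the uniform distribution on
the `k`-element set `[k]`. -/
def sphereProdMeasure (k : ℕ) [NeZero m] : Measure (USphere 𝕜 m × Fin k) :=
  (sphereMeasure 𝕜 m).prod ((k : ℝ≥0∞)⁻¹ • Measure.count)

end Sphere

end

end CutNorm

/-! For points `u`, `v` of a homogeneous space, averaging `f` over the points `V v` with `V u = x`
defines a covariant operator whose form is the Haar integral of `conj (g (U u)) * f (U v)` over `U`.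
Linear combinations stay covariant, and their forms are Haar averages of finite sums
(`innerL2_orbitSum`).

Take a matrix `A` and vectors nearly attaining the Grothendieck constant, move the vectors to a unit
sphere without changing the inner products `⟨x i, y j⟩`, and give the pair `(u i, v j)` the weight
`A i j / n`. A trace over the normalized coordinate functions bounds the L2 norm below by the
Grothendieck value (`le_opNormL2_orbitSum`). For the cut norm, the integrand at each fixed `U` is
the form of `A` evaluated at values of `f` and `g`, hence is controlled by `normInftyOne`.

The extra factor comes from first replacing `f` by the average of `conj (ζ k) * f (ζ k x)` over
unimodular `ζ k`, and likewise `g`. Coordinate functions are unchanged, while a [0,1]-valued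
function shrinks to modulus at most `δ` (`norm_phase_average_le`), so the ratio of the norms gains
`δ⁻²`. The signs `±1` give `δ = 1/2`; the `N`-th roots of unity give `δ → 1/π`, the mean of the
positive part of cosine. A single copy of the sphere, `k = 1`, suffices. -/

open MeasureTheory
open scoped ENNReal

namespace CutNorm

noncomputable section

set_option linter.unusedSectionVars false

/-! ### Bi-invariance of Haar probability on a compact group. -/

section HaarProb

variable {Γ : Type} [Group Γ] [TopologicalSpace Γ] [IsTopologicalGroup Γ] [CompactSpace Γ]
  [MeasurableSpace Γ] [BorelSpace Γ]

instance : IsProbabilityMeasure (haarProb Γ) :=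
  ⟨Measure.haarMeasure_self (K₀ := (⊤ : TopologicalSpace.PositiveCompacts Γ))⟩

instance : (haarProb Γ).IsHaarMeasure := Measure.isHaarMeasure_haarMeasure _

instance : (haarProb Γ).Regular := Measure.regular_haarMeasure

/-- Right translations commute with left ones, so the image is again a left Haar probability
measure, and such a measure is unique. -/
theorem map_mul_right_haarProb (a : Γ) :
    Measure.map (fun x : Γ => x * a) (haarProb Γ) = haarProb Γ := by
  have : IsProbabilityMeasure (Measure.map (fun x : Γ => x * a) (haarProb Γ)) :=
    Measure.isProbabilityMeasure_map (continuous_mul_const a).aemeasurable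
  have : (Measure.map (fun x : Γ => x * a) (haarProb Γ)).Regular :=
    Measure.Regular.map (Homeomorph.mulRight a)
  exact Measure.isHaarMeasure_eq_of_isProbabilityMeasure _ _

instance : (haarProb Γ).IsMulRightInvariant := ⟨map_mul_right_haarProb⟩

theorem integrable_haarProb {E : Type*} [NormedAddCommGroup E] [SecondCountableTopology E]
    {f : Γ → E} (hf : Continuous f) : Integrable f (haarProb Γ) := by
  borelize E
  have := (isCompact_univ (X := Γ)).exists_bound_of_continuousOn hf.continuousOn
  obtain ⟨C, hC⟩ := this
  exact Integrable.of_bound hf.measurable.aestronglyMeasurable C (.of_forall fun x => hC x trivial)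

end HaarProb

/-! ### Covariant operators attached to a pair of points. -/

section OrbitOperator

variable {𝕜 : Type} [RCLike 𝕜] {X : Type} [TopologicalSpace X] [T2Space X]
  {Γ : Type} [Group Γ] [TopologicalSpace Γ] [IsTopologicalGroup Γ] [CompactSpace Γ]
  [FirstCountableTopology Γ] [MeasurableSpace Γ] [BorelSpace Γ] [MulAction Γ X]
  [ContinuousSMul Γ X]

instance compactSpace_stabilizer (u : X) : CompactSpace (MulAction.stabilizer Γ u) := by
  refine isCompact_iff_compactSpace.1 (IsClosed.isCompact ?_)
  exact isClosed_eq (continuous_id.smul continuous_const) continuous_const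

variable (Γ) in
/-- The average of `f (U s v)` over `s` in the stabilizer of `u`, as a function of `U`. -/
def stabilizerAverage (u v : X) (f : C(X, 𝕜)) : C(Γ, 𝕜) where
  toFun U := ∫ s : MulAction.stabilizer Γ u, f ((U * (s : Γ)) • v)
    ∂haarProb (MulAction.stabilizer Γ u)
  continuous_toFun := by
    have h := continuous_parametric_integral_of_continuous
      (μ := haarProb (MulAction.stabilizer Γ u))
      (f := fun (U : Γ) (s : MulAction.stabilizer Γ u) => f ((U * (s : Γ)) • v))
      (by simp only [Function.uncurry_def]; fun_prop) isCompact_univ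
    simpa using h

/-- Here `U = V t` with `t` in the stabilizer of `u`, and left invariance absorbs `t`. The average
therefore descends to a function of `U • u`. -/
theorem stabilizerAverage_congr (u v : X) (f : C(X, 𝕜)) {U V : Γ} (h : U • u = V • u) :
    stabilizerAverage Γ u v f U = stabilizerAverage Γ u v f V := by
  let t : MulAction.stabilizer Γ u := ⟨V⁻¹ * U, by
    rw [MulAction.mem_stabilizer_iff, mul_smul, h, inv_smul_smul]⟩
  have ht : ∀ s : MulAction.stabilizer Γ u, U * (s : Γ) = V * ((t * s : _) : Γ) := fun s => by
    simp [t, mul_assoc]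
  simp only [stabilizerAverage, ContinuousMap.coe_mk, ht]
  exact integral_mul_left_eq_self (fun s : MulAction.stabilizer Γ u => f ((V * (s : Γ)) • v)) t

variable [MulAction.IsPretransitive Γ X]

variable (Γ) in
/-- The map `U ↦ U u`. -/
def orbitMap (u : X) : C(Γ, X) := ⟨fun U => U • u, continuous_id.smul continuous_const⟩

-- A continuous surjection from a compact space to a Hausdorff space is closed, hence a quotient
-- map; this makes the descended average continuous.
variable (Γ) in
theorem isQuotientMap_orbitMap (u : X) : Topology.IsQuotientMap (orbitMap Γ u) :=
  (orbitMap Γ u).continuous.isClosedMap.isQuotientMap (orbitMap Γ u).continuous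
    (MulAction.surjective_smul Γ u)

variable (Γ) in
/-- The average of `f (V v)` over all `V ∈ Γ` with `V u = x`, as a function of `x`. -/
def orbitAverage (u v : X) (f : C(X, 𝕜)) : C(X, 𝕜) :=
  (isQuotientMap_orbitMap Γ u).lift (stabilizerAverage Γ u v f)
    (fun U V (h : U • u = V • u) => stabilizerAverage_congr u v f h)

theorem orbitAverage_smul (u v : X) (f : C(X, 𝕜)) (U : Γ) :
    orbitAverage Γ u v f (U • u) = ∫ s : MulAction.stabilizer Γ u, f ((U * (s : Γ)) • v)
      ∂haarProb (MulAction.stabilizer Γ u) :=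
  congrArg (fun F : C(Γ, 𝕜) => F U)
    ((isQuotientMap_orbitMap Γ u).lift_comp (stabilizerAverage Γ u v f)
      (fun U V (h : U • u = V • u) => stabilizerAverage_congr u v f h))

variable (Γ) in
/-- `orbitAverage` as a bounded linear operator. -/
def orbitOperator [CompactSpace X] (u v : X) : C(X, 𝕜) →L[𝕜] C(X, 𝕜) :=
  LinearMap.mkContinuous
    { toFun := orbitAverage Γ u v
      map_add' := fun f g => by
        ext x
        obtain ⟨U, rfl⟩ := MulAction.exists_smul_eq Γ u x
        simp only [ContinuousMap.add_apply, orbitAverage_smul]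
        exact integral_add (integrable_haarProb (by fun_prop)) (integrable_haarProb (by fun_prop))
      map_smul' := fun c f => by
        ext x
        obtain ⟨U, rfl⟩ := MulAction.exists_smul_eq Γ u x
        simp only [ContinuousMap.smul_apply, orbitAverage_smul, RingHom.id_apply]
        exact integral_smul _ _ } 1 fun f => by
    rw [one_mul, ContinuousMap.norm_le _ (norm_nonneg f)]
    intro x
    obtain ⟨U, rfl⟩ := MulAction.exists_smul_eq Γ u x
    simp only [LinearMap.coe_mk, AddHom.coe_mk, orbitAverage_smul]
    refine (norm_integral_le_of_norm_le_const (C := ‖f‖)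
      (.of_forall fun s => f.norm_coe_le_norm _)).trans ?_
    simp

variable [CompactSpace X]

theorem orbitOperator_smul (u v : X) (f : C(X, 𝕜)) (U : Γ) :
    orbitOperator Γ u v f (U • u) = ∫ s : MulAction.stabilizer Γ u, f ((U * (s : Γ)) • v)
      ∂haarProb (MulAction.stabilizer Γ u) :=
  orbitAverage_smul u v f U

theorem translate_orbitOperator (u v : X) (π : Γ) (f : C(X, 𝕜)) :
    translate π⁻¹ (orbitOperator Γ u v (translate π f)) = orbitOperator Γ u v f := by
  ext x
  obtain ⟨U, rfl⟩ := MulAction.exists_smul_eq Γ u x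
  simp only [translate, ContinuousMap.coe_mk, smul_smul, orbitOperator_smul, mul_assoc,
    mul_inv_cancel_left]

variable [MeasurableSpace X] [BorelSpace X]

theorem integral_eq_integral_orbit {ν : Measure X} {u : X}
    (hν : Measure.map (fun U : Γ => U • u) (haarProb Γ) = ν) {h : X → 𝕜} (hh : Continuous h) :
    ∫ x, h x ∂ν = ∫ U : Γ, h (U • u) ∂haarProb Γ := by
  rw [← hν, integral_map]
  · exact (continuous_id.smul continuous_const).aemeasurable
  · exact hh.measurable.aestronglyMeasurable

theorem innerL2_orbitOperator {ν : Measure X} {u : X}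
    (hν : Measure.map (fun U : Γ => U • u) (haarProb Γ) = ν) (v : X) (f g : C(X, 𝕜)) :
    innerL2 ν g (orbitOperator Γ u v f) =
      ∫ U : Γ, star (g (U • u)) * f (U • v) ∂haarProb Γ := by
  rw [innerL2, integral_eq_integral_orbit hν (by fun_prop)]
  simp only [orbitOperator_smul, ← integral_const_mul]
  rw [integral_integral_swap_of_hasCompactSupport]
  -- After Fubini, substituting `U * s` for `U` leaves `g (U • u)` fixed because `s` stabilizes `u`,
  -- so the inner integral does not depend on `s`.
  · have h : ∀ s : MulAction.stabilizer Γ u,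
        ∫ U : Γ, star (g (U • u)) * f ((U * (s : Γ)) • v) ∂haarProb Γ =
          ∫ U : Γ, star (g (U • u)) * f (U • v) ∂haarProb Γ := fun s => by
      rw [← integral_mul_right_eq_self (fun U : Γ => star (g (U • u)) * f (U • v)) (s : Γ)]
      refine integral_congr_ae (.of_forall fun U => ?_)
      have hs : (s : Γ) • u = u := s.2
      simp only [mul_smul U (s : Γ) u, hs]
    rw [integral_congr_ae (.of_forall h)]
    simp
  · simp only [Function.uncurry_def]; fun_prop
  · exact HasCompactSupport.of_compactSpace _

end OrbitOperator

/-! ### [0,1]-valued functions span `C(X)`. -/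

section UnitInterval

variable {𝕜 : Type} [RCLike 𝕜] {X : Type} [TopologicalSpace X]

theorem UnitIntervalValued.linearMap_eq_zero [CompactSpace X] {L : C(X, 𝕜) →ₗ[𝕜] 𝕜}
    (hL : ∀ f, UnitIntervalValued f → L f = 0) : L = 0 := by
  have h1 : L 1 = 0 := hL 1 fun x => ⟨1, by simp⟩
  let emb (h : C(X, ℝ)) : C(X, 𝕜) := ⟨fun x => (h x : 𝕜), by fun_prop⟩
  have hreal : ∀ h : C(X, ℝ), L (emb h) = 0 := fun h => by
    -- The summand 1 keeps `C` positive when `h = 0`; then `(h + C) / (2C)` takes values in [0,1].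
    set C := ‖h‖ + 1
    have hC : 0 < C := by positivity
    have hx (x : X) : |h x| ≤ C := (h.norm_coe_le_norm x).trans (by simp [C])
    let φ : C(X, ℝ) := ⟨fun x => (h x + C) / (2 * C), by fun_prop⟩
    have hφ : L (emb φ) = 0 := hL _ fun x => by
      refine ⟨φ x, div_nonneg ?_ (by positivity), (div_le_one (by positivity)).2 ?_, rfl⟩ <;>
        linarith [abs_le.1 (hx x)]
    have : emb h = ((2 * C : ℝ) : 𝕜) • emb φ - (C : 𝕜) • 1 := by
      ext x
      have : h x = 2 * C * φ x - C := by simp only [φ, ContinuousMap.coe_mk]; field_simp; ring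
      simp [emb, this, RCLike.real_smul_eq_coe_mul]
    rw [this, map_sub, map_smul, map_smul, hφ, h1]; simp
  ext f
  have : f = emb ⟨fun x => RCLike.re (f x), by fun_prop⟩ +
      (RCLike.I : 𝕜) • emb ⟨fun x => RCLike.im (f x), by fun_prop⟩ := by
    ext x
    simp only [emb, ContinuousMap.add_apply, ContinuousMap.smul_apply, ContinuousMap.coe_mk,
      smul_eq_mul]
    rw [mul_comm, RCLike.re_add_im]
  rw [this, map_add, map_smul, hreal, hreal]; simp

end UnitInterval

/-! ### A vanishing cut norm forces a vanishing form. -/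

section Vanishing

variable {𝕜 : Type} [RCLike 𝕜] {X : Type} [TopologicalSpace X] [CompactSpace X]
  [MeasurableSpace X] [BorelSpace X] {ν : Measure X} [IsFiniteMeasure ν]

theorem integrable_of_continuous {f : X → 𝕜} (hf : Continuous f) : Integrable f ν := by
  obtain ⟨C, hC⟩ := (isCompact_univ (X := X)).exists_bound_of_continuousOn hf.continuousOn
  exact Integrable.of_bound hf.measurable.aestronglyMeasurable C (.of_forall fun x => hC x trivial)

variable (ν) in
/-- `innerL2` as a linear functional of its second argument. -/
def innerL2Linear (g : C(X, 𝕜)) : C(X, 𝕜) →ₗ[𝕜] 𝕜 where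
  toFun := innerL2 ν g
  map_add' f₁ f₂ := by
    simp only [innerL2, ContinuousMap.add_apply, mul_add]
    exact integral_add (integrable_of_continuous (by fun_prop))
      (integrable_of_continuous (by fun_prop))
  map_smul' c f := by
    simp only [innerL2, ContinuousMap.smul_apply, smul_eq_mul, mul_left_comm _ c,
      integral_const_mul, RingHom.id_apply]

theorem star_innerL2 (f g : C(X, 𝕜)) : star (innerL2 ν f g) = innerL2 ν g f := by
  simp only [innerL2, RCLike.star_def, ← integral_conj, map_mul, RCLike.conj_conj]
  simp only [mul_comm]

theorem innerL2_eq_zero_of_cutNorm_eq_zero {M : C(X, 𝕜) →L[𝕜] C(X, 𝕜)}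
    (hM : cutNorm ν M = 0) (f g : C(X, 𝕜)) : innerL2 ν g (M f) = 0 := by
  have h1 : ∀ f g : C(X, 𝕜), UnitIntervalValued f → UnitIntervalValued g →
      innerL2 ν g (M f) = 0 := fun f g hf hg => by
    simp only [cutNorm, ENNReal.iSup_eq_zero, ENNReal.ofReal_eq_zero] at hM
    exact norm_le_zero_iff.1 (hM f g hf hg)
  have h2 : ∀ f g : C(X, 𝕜), UnitIntervalValued g → innerL2 ν g (M f) = 0 := fun f g hg =>
    LinearMap.congr_fun (UnitIntervalValued.linearMap_eq_zero
      (L := (innerL2Linear ν g).comp (M : C(X, 𝕜) →ₗ[𝕜] C(X, 𝕜))) fun f hf => h1 f g hf hg) f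
  -- The form is conjugate linear in `g`, so the spanning argument is applied to its conjugate.
  have h3 : innerL2 ν (M f) g = 0 :=
    LinearMap.congr_fun (UnitIntervalValued.linearMap_eq_zero (L := innerL2Linear ν (M f))
      fun g hg => by
        change innerL2 ν (M f) g = 0
        rw [← star_innerL2, h2 f g hg, star_zero]) g
  rw [← star_innerL2, h3, star_zero]

end Vanishing

/-! ### Linear combinations of orbit operators and their norms. -/

section OrbitSum

variable {𝕜 : Type} [RCLike 𝕜] {X : Type} [TopologicalSpace X] [T2Space X] [CompactSpace X]
  {Γ : Type} [Group Γ] [TopologicalSpace Γ] [IsTopologicalGroup Γ] [CompactSpace Γ]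
  [FirstCountableTopology Γ] [MeasurableSpace Γ] [BorelSpace Γ] [MulAction Γ X]
  [ContinuousSMul Γ X] [MulAction.IsPretransitive Γ X] {I : Type} [Fintype I]

variable (Γ) in
/-- The linear combination of the orbit operators of the pairs `(p a, q a)` with weights `c a`. -/
def orbitSum (c : I → 𝕜) (p q : I → X) : C(X, 𝕜) →L[𝕜] C(X, 𝕜) :=
  ∑ a, c a • orbitOperator Γ (p a) (q a)

variable (c : I → 𝕜) (p q : I → X)

theorem translate_orbitSum (π : Γ) (f : C(X, 𝕜)) :
    translate π⁻¹ (orbitSum Γ c p q (translate π f)) = orbitSum Γ c p q f := by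
  ext x
  have h (a : I) := congrArg (fun F : C(X, 𝕜) => F x) (translate_orbitOperator (p a) (q a) π f)
  simp only [translate, ContinuousMap.coe_mk] at h
  simp only [translate, orbitSum, ContinuousMap.coe_mk, sum_apply,
    ContinuousMap.sum_apply, smul_apply, ContinuousMap.smul_apply, h]

variable [MeasurableSpace X] [BorelSpace X] {ν : Measure X}

theorem innerL2_orbitSum
    (hν : ∀ u : X, Measure.map (fun U : Γ => U • u) (haarProb Γ) = ν) (f g : C(X, 𝕜)) :
    innerL2 ν g (orbitSum Γ c p q f) =
      ∫ U : Γ, ∑ a, c a * (star (g (U • p a)) * f (U • q a)) ∂haarProb Γ := by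
  rw [integral_finsetSum _ fun a _ => integrable_haarProb (by fun_prop)]
  rcases isEmpty_or_nonempty X with hX | ⟨⟨x⟩⟩
  · have : IsEmpty I := ⟨fun a => hX.elim (p a)⟩
    simp [innerL2, orbitSum]
  have : IsFiniteMeasure ν := by
    rw [← hν x]; infer_instance
  change innerL2Linear ν g _ = _
  simp only [orbitSum, sum_apply, smul_apply, map_sum,
    map_smul, integral_const_mul, smul_eq_mul]
  exact Finset.sum_congr rfl fun a _ =>
    congrArg (c a * ·) (innerL2_orbitOperator (hν (p a)) (q a) f g)

theorem integral_orbit_norm_sq_le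
    (hν : ∀ u : X, Measure.map (fun U : Γ => U • u) (haarProb Γ) = ν) {f : C(X, 𝕜)}
    (hf : normL2 ν f ≤ 1) (u : X) : ∫ U : Γ, ‖f (U • u)‖ ^ 2 ∂haarProb Γ ≤ 1 := by
  rw [← integral_eq_integral_orbit (𝕜 := ℝ) (h := fun x => ‖f x‖ ^ 2) (hν u) (by fun_prop)]
  rwa [normL2, Real.sqrt_le_one] at hf

/-- By `ab ≤ (a² + b²)/2` pointwise, and because each orbit map carries Haar measure to `ν`, the
norm is at most the sum of the `‖c a‖`. -/
theorem opNormL2_orbitSum_ne_top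
    (hν : ∀ u : X, Measure.map (fun U : Γ => U • u) (haarProb Γ) = ν) :
    opNormL2 ν (orbitSum Γ c p q) ≠ ∞ := by
  refine ne_top_of_le_ne_top (ENNReal.ofReal_ne_top (r := ∑ a, ‖c a‖)) ?_
  simp only [opNormL2, iSup_le_iff]
  intro f g hf hg
  refine ENNReal.ofReal_le_ofReal ?_
  rw [innerL2_orbitSum c p q hν]
  have hint : ∀ a, Integrable (fun U : Γ => ‖c a‖ * ((‖g (U • p a)‖ ^ 2 + ‖f (U • q a)‖ ^ 2) / 2))
      (haarProb Γ) := fun a => integrable_haarProb (by fun_prop)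
  calc _ ≤ ∫ U : Γ, ∑ a, ‖c a‖ * ((‖g (U • p a)‖ ^ 2 + ‖f (U • q a)‖ ^ 2) / 2) ∂haarProb Γ := by
        refine norm_integral_le_of_norm_le (integrable_finsetSum _ fun a _ => hint a)
          (.of_forall fun U => (norm_sum_le _ _).trans (Finset.sum_le_sum fun a _ => ?_))
        rw [norm_mul, norm_mul, norm_star]
        gcongr
        nlinarith [sq_nonneg (‖g (U • p a)‖ - ‖f (U • q a)‖)]
    _ ≤ _ := by
        rw [integral_finsetSum _ fun a _ => hint a]
        refine Finset.sum_le_sum fun a _ => ?_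
        rw [integral_const_mul, integral_div, integral_add (integrable_haarProb (by fun_prop))
          (integrable_haarProb (by fun_prop))]
        refine mul_le_of_le_one_right (norm_nonneg _) ?_
        linarith [integral_orbit_norm_sq_le hν hg (p a), integral_orbit_norm_sq_le hν hf (q a)]

theorem cutNorm_orbitSum_le
    (hν : ∀ u : X, Measure.map (fun U : Γ => U • u) (haarProb Γ) = ν) {C : ℝ}
    (hC : ∀ f g : C(X, 𝕜), UnitIntervalValued f → UnitIntervalValued g → ∀ U : Γ,
      ‖∑ a, c a * (star (g (U • p a)) * f (U • q a))‖ ≤ C) :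
    cutNorm ν (orbitSum Γ c p q) ≤ ENNReal.ofReal C := by
  simp only [cutNorm, iSup_le_iff]
  intro f g hf hg
  refine ENNReal.ofReal_le_ofReal ?_
  rw [innerL2_orbitSum c p q hν]
  refine (norm_integral_le_of_norm_le_const (.of_forall (hC f g hf hg))).trans ?_
  simp

end OrbitSum

/-! ### The unitary group acting on the sphere, and the trace bound. -/

section SphereAction

variable {𝕜 : Type} [RCLike 𝕜] {m : ℕ}

theorem rotate_apply (U : UGroup 𝕜 m) (x : USphere 𝕜 m) (i : Fin m) :
    (rotate U x).1 i = ∑ j, U.1 i j * x.1 j := rfl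

theorem rotate_one (x : USphere 𝕜 m) : rotate 1 x = x := by
  refine Subtype.ext (PiLp.ext fun i => ?_)
  change ((1 : Matrix (Fin m) (Fin m) 𝕜).mulVec x.1.ofLp) i = _
  rw [Matrix.one_mulVec]

theorem rotate_mul (U V : UGroup 𝕜 m) (x : USphere 𝕜 m) :
    rotate (U * V) x = rotate U (rotate V x) := by
  refine Subtype.ext (PiLp.ext fun i => ?_)
  change ((U.1 * V.1).mulVec x.1.ofLp) i = (U.1.mulVec (V.1.mulVec x.1.ofLp)) i
  rw [Matrix.mulVec_mulVec]

theorem continuous_rotate : Continuous fun p : UGroup 𝕜 m × USphere 𝕜 m => rotate p.1 p.2 := by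
  refine Continuous.subtype_mk ((PiLp.continuous_toLp 2 _).comp ?_) _
  refine Continuous.matrix_mulVec (continuous_subtype_val.comp continuous_fst) ?_
  exact (PiLp.continuous_ofLp 2 _).comp (continuous_subtype_val.comp continuous_snd)

theorem inner_rotate (U : UGroup 𝕜 m) (x y : USphere 𝕜 m) :
    inner 𝕜 (rotate U x).1 (rotate U y).1 = inner 𝕜 x.1 y.1 := by
  have h : U.1.conjTranspose * U.1 = 1 := Matrix.mem_unitaryGroup_iff'.1 U.2
  simp only [rotate, EuclideanSpace.inner_eq_star_dotProduct]
  rw [dotProduct_comm, Matrix.star_mulVec, ← Matrix.dotProduct_mulVec, Matrix.mulVec_mulVec, h,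
    Matrix.one_mulVec, dotProduct_comm]

theorem exists_rotate_basePoint_eq [NeZero m] (x : USphere 𝕜 m) :
    ∃ U : UGroup 𝕜 m, rotate U (basePoint 𝕜 m) = x := by
  have hx : ‖x.1‖ = 1 := mem_sphere_zero_iff_norm.1 x.2
  -- The unitary sought has an orthonormal basis as its columns, the first of them being `x`.
  obtain ⟨b, hb⟩ := Orthonormal.exists_orthonormalBasis_extension_of_card_eq (𝕜 := 𝕜)
    (E := EuclideanSpace 𝕜 (Fin m)) (ι := Fin m) (by simp) (v := fun _ => x.1) (s := {0})
    (by
      rw [orthonormal_iff_ite]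
      rintro ⟨i, rfl⟩ ⟨j, rfl⟩
      simp [inner_self_eq_norm_sq_to_K, hx])
  refine ⟨⟨(EuclideanSpace.basisFun (Fin m) 𝕜).toBasis.toMatrix b,
    (EuclideanSpace.basisFun (Fin m) 𝕜).toMatrix_orthonormalBasis_mem_unitary b⟩, ?_⟩
  refine Subtype.ext (PiLp.ext fun i => ?_)
  rw [rotate_apply]
  simp [basePoint, Module.Basis.toMatrix_apply, hb 0 (Set.mem_singleton _)]

instance : FirstCountableTopology (UGroup 𝕜 m) :=
  have : FirstCountableTopology (Matrix (Fin m) (Fin m) 𝕜) :=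
    inferInstanceAs (FirstCountableTopology (Fin m → Fin m → 𝕜))
  Topology.IsInducing.subtypeVal.firstCountableTopology

instance sphereSMul : SMul (UGroup 𝕜 m) (USphere 𝕜 m × Fin 1) where
  smul U x := (rotate U x.1, x.2)

instance sphereMulAction : MulAction (UGroup 𝕜 m) (USphere 𝕜 m × Fin 1) where
  one_smul x := Prod.ext (rotate_one x.1) rfl
  mul_smul U V x := Prod.ext (rotate_mul U V x.1) rfl

theorem smul_fst (U : UGroup 𝕜 m) (x : USphere 𝕜 m × Fin 1) : (U • x).1 = rotate U x.1 := rfl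

instance : ContinuousSMul (UGroup 𝕜 m) (USphere 𝕜 m × Fin 1) where
  continuous_smul := by
    have h : Continuous fun p : UGroup 𝕜 m × (USphere 𝕜 m × Fin 1) => (p.1, p.2.1) := by fun_prop
    exact (continuous_rotate.comp h).prodMk (continuous_snd.comp continuous_snd)

variable [NeZero m]

instance : MulAction.IsPretransitive (UGroup 𝕜 m) (USphere 𝕜 m × Fin 1) where
  exists_smul_eq x y := by
    obtain ⟨U, hU⟩ := exists_rotate_basePoint_eq x.1
    obtain ⟨V, hV⟩ := exists_rotate_basePoint_eq y.1
    refine ⟨V * U⁻¹, Prod.ext ?_ (Subsingleton.elim _ _)⟩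
    rw [smul_fst, rotate_mul, ← hU, ← rotate_mul U⁻¹, inv_mul_cancel, rotate_one, hV]

theorem map_smul_haarProb (x : USphere 𝕜 m × Fin 1) :
    Measure.map (fun U : UGroup 𝕜 m => U • x) (haarProb (UGroup 𝕜 m)) =
      sphereProdMeasure 𝕜 m 1 := by
  have hc (y : USphere 𝕜 m × Fin 1) : Measurable fun U : UGroup 𝕜 m => U • y :=
    (continuous_id.smul continuous_const).measurable
  obtain ⟨V, rfl⟩ := MulAction.exists_smul_eq (UGroup 𝕜 m) (basePoint 𝕜 m, (0 : Fin 1)) x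
  have h1 : (fun U : UGroup 𝕜 m => U • V • (basePoint 𝕜 m, (0 : Fin 1))) =
      (fun U : UGroup 𝕜 m => U • (basePoint 𝕜 m, (0 : Fin 1))) ∘ (· * V) := by
    ext1 U; simp [mul_smul]
  rw [h1, ← Measure.map_map (hc _) (continuous_mul_const V).measurable, map_mul_right_haarProb]
  have h2 : (Measure.count : Measure (Fin 1)) = Measure.dirac 0 := by
    rw [Measure.count, Measure.sum_fintype]; simp
  have hm : Measurable fun U : UGroup 𝕜 m => rotate U (basePoint 𝕜 m) :=
    measurable_fst.comp (hc (basePoint 𝕜 m, (0 : Fin 1)))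
  have hs : SFinite (sphereMeasure 𝕜 m) := by rw [sphereMeasure]; infer_instance
  rw [sphereProdMeasure, h2, Nat.cast_one, inv_one, one_smul, Measure.prod_dirac, sphereMeasure,
    Measure.map_map (by fun_prop) hm]
  rfl

theorem isTransitiveCovariant_orbitSum {I : Type} [Fintype I] (c : I → 𝕜)
    (p q : I → USphere 𝕜 m × Fin 1) :
    IsTransitiveCovariant (sphereProdMeasure 𝕜 m 1) (orbitSum (UGroup 𝕜 m) c p q) :=
  ⟨UGroup 𝕜 m, inferInstance, inferInstance, inferInstance, inferInstance, inferInstance,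
    inferInstance, inferInstance, inferInstance, inferInstance, inferInstance, map_smul_haarProb,
    translate_orbitSum c p q⟩

theorem exists_rotate_apply_eq_apply_perm (σ : Equiv.Perm (Fin m)) :
    ∃ P : UGroup 𝕜 m, ∀ x i, (rotate P x).1 i = x.1 (σ i) := by
  refine ⟨⟨σ.permMatrix 𝕜, Matrix.mem_unitaryGroup_iff.2 ?_⟩, fun x i => ?_⟩
  · rw [Matrix.star_eq_conjTranspose, Matrix.conjTranspose_permMatrix, ← Matrix.permMatrix_mul]
    simp
  · change ((σ.permMatrix 𝕜).mulVec x.1.ofLp) i = _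
    rw [Matrix.permMatrix_mulVec]; rfl

theorem sum_norm_sq_apply (x : USphere 𝕜 m) : ∑ i, ‖x.1 i‖ ^ 2 = 1 := by
  rw [← EuclideanSpace.norm_sq_eq, mem_sphere_zero_iff_norm.1 x.2, one_pow]

/-- Permutation matrices are unitary, so all coordinates have the same second moment, and these
moments sum to 1. -/
theorem integral_norm_sq_apply (i : Fin m) :
    ∫ x, ‖x.1.1 i‖ ^ 2 ∂sphereProdMeasure 𝕜 m 1 = (m : ℝ)⁻¹ := by
  let x₀ : USphere 𝕜 m × Fin 1 := (basePoint 𝕜 m, 0)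
  have hU (j : Fin m) : Continuous fun U : UGroup 𝕜 m => ‖(U • x₀).1.1 j‖ ^ 2 := by fun_prop
  have heq (j : Fin m) : ∫ x, ‖x.1.1 j‖ ^ 2 ∂sphereProdMeasure 𝕜 m 1 =
      ∫ U : UGroup 𝕜 m, ‖(U • x₀).1.1 j‖ ^ 2 ∂haarProb (UGroup 𝕜 m) :=
    integral_eq_integral_orbit (𝕜 := ℝ) (map_smul_haarProb x₀)
      (h := fun x : USphere 𝕜 m × Fin 1 => ‖x.1.1 j‖ ^ 2) (by fun_prop)
  have hsymm (j : Fin m) : ∫ U : UGroup 𝕜 m, ‖(U • x₀).1.1 j‖ ^ 2 ∂haarProb (UGroup 𝕜 m) =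
      ∫ U : UGroup 𝕜 m, ‖(U • x₀).1.1 i‖ ^ 2 ∂haarProb (UGroup 𝕜 m) := by
    obtain ⟨P, hP⟩ := exists_rotate_apply_eq_apply_perm (𝕜 := 𝕜) (Equiv.swap i j)
    rw [← integral_mul_left_eq_self _ P]
    simp only [mul_smul, smul_fst, hP, Equiv.swap_apply_right]
  have hsum : ∑ j, ∫ U : UGroup 𝕜 m, ‖(U • x₀).1.1 j‖ ^ 2 ∂haarProb (UGroup 𝕜 m) = 1 := by
    rw [← integral_finsetSum _ fun j _ => integrable_haarProb (hU j)]
    simp [sum_norm_sq_apply]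
  simp only [hsymm, Finset.sum_const, Finset.card_univ, Fintype.card_fin, nsmul_eq_mul] at hsum
  rw [heq]
  exact eq_inv_of_mul_eq_one_right hsum

/-- The `i`-th coordinate function, scaled to have `L2` norm one. -/
def coordinate (i : Fin m) : C(USphere 𝕜 m × Fin 1, 𝕜) :=
  ⟨fun x => (√m : ℝ) * x.1.1 i, by fun_prop⟩

theorem normL2_coordinate (i : Fin m) :
    normL2 (sphereProdMeasure 𝕜 m 1) (coordinate i) = 1 := by
  have hm : (m : ℝ) ≠ 0 := NeZero.ne _
  simp only [normL2, coordinate, ContinuousMap.coe_mk, norm_mul, mul_pow, RCLike.norm_ofReal,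
    abs_of_nonneg (Real.sqrt_nonneg _), Real.sq_sqrt (Nat.cast_nonneg m)]
  rw [integral_const_mul, integral_norm_sq_apply, mul_inv_cancel₀ hm, Real.sqrt_one]

/-- Summed over the coordinate functions, the integrand equals `m * S` for every `U`, since
unitaries preserve inner products. Hence one of the `m` diagonal entries has modulus at least `‖S‖`.
-/
theorem le_opNormL2_orbitSum {I : Type} [Fintype I] (c : I → 𝕜)
    (p q : I → USphere 𝕜 m × Fin 1) :
    ENNReal.ofReal ‖∑ a, c a * inner 𝕜 (p a).1.1 (q a).1.1‖ ≤
      opNormL2 (sphereProdMeasure 𝕜 m 1) (orbitSum (UGroup 𝕜 m) c p q) := by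
  set S := ∑ a, c a * inner 𝕜 (p a).1.1 (q a).1.1
  set M := orbitSum (UGroup 𝕜 m) c p q
  set b : Fin m → 𝕜 := fun i => innerL2 (sphereProdMeasure 𝕜 m 1) (coordinate i) (M (coordinate i))
  have hb : ∑ i, b i = m * S := by
    simp only [b, M, innerL2_orbitSum c p q map_smul_haarProb]
    rw [← integral_finsetSum _ fun i _ => integrable_haarProb (by fun_prop)]
    have hU (U : UGroup 𝕜 m) : ∑ i, ∑ a, c a * (star ((coordinate i : C(_, 𝕜)) (U • p a)) *
        (coordinate i : C(_, 𝕜)) (U • q a)) = m * S := by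
      rw [Finset.sum_comm, Finset.mul_sum]
      refine Finset.sum_congr rfl fun a _ => ?_
      rw [← inner_rotate U, PiLp.inner_apply, Finset.mul_sum, Finset.mul_sum]
      refine Finset.sum_congr rfl fun i _ => ?_
      have hs : ((√m : ℝ) : 𝕜) * ((√m : ℝ) : 𝕜) = m := by
        rw [← RCLike.ofReal_mul, Real.mul_self_sqrt (Nat.cast_nonneg m), RCLike.ofReal_natCast]
      simp only [coordinate, ContinuousMap.coe_mk, smul_fst, star_mul', RCLike.star_def,
        RCLike.conj_ofReal, RCLike.inner_apply]
      linear_combination (c a * (starRingEnd 𝕜) ((rotate U (p a).1).1 i) *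
        (rotate U (q a).1).1 i) * hs
    rw [integral_congr_ae (.of_forall hU)]
    simp
  obtain ⟨i, -, hi⟩ : ∃ i ∈ Finset.univ, ‖S‖ ≤ ‖b i‖ := by
    refine Finset.exists_le_of_sum_le (f := fun _ : Fin m => ‖S‖) ⟨0, Finset.mem_univ _⟩ ?_
    calc ∑ _i : Fin m, ‖S‖ = ‖(m : 𝕜) * S‖ := by simp
      _ = ‖∑ i, b i‖ := by rw [hb]
      _ ≤ _ := norm_sum_le _ _
  refine (ENNReal.ofReal_le_ofReal hi).trans ?_
  exact le_iSup₂_of_le (coordinate i) (coordinate i) (le_iSup₂_of_le (normL2_coordinate i).le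
    (normL2_coordinate i).le le_rfl)

end SphereAction

/-! ### Scaling of the ℓ∞ → ℓ1 norm. -/

section InftyOne

variable {𝕜 : Type} [RCLike 𝕜] {n : ℕ}

theorem bddAbove_normInftyOne (A : Matrix (Fin n) (Fin n) 𝕜) :
    BddAbove {r : ℝ | ∃ x y : Fin n → 𝕜, (∀ i, ‖x i‖ ≤ 1) ∧ (∀ i, ‖y i‖ ≤ 1) ∧
      r = ‖(n : 𝕜)⁻¹ * ∑ i, star (y i) * A.mulVec x i‖} := by
  refine ⟨‖(n : 𝕜)⁻¹‖ * ∑ i, ∑ j, ‖A i j‖, ?_⟩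
  rintro _ ⟨x, y, hx, hy, rfl⟩
  rw [norm_mul]
  gcongr
  refine (norm_sum_le _ _).trans (Finset.sum_le_sum fun i _ => ?_)
  rw [norm_mul, norm_star]
  refine (mul_le_of_le_one_left (norm_nonneg _) (hy i)).trans ?_
  rw [Matrix.mulVec, dotProduct]
  refine (norm_sum_le _ _).trans (Finset.sum_le_sum fun j _ => ?_)
  rw [norm_mul]
  exact mul_le_of_le_one_right (norm_nonneg _) (hx j)

theorem normInftyOne_nonneg (A : Matrix (Fin n) (Fin n) 𝕜) : 0 ≤ normInftyOne 𝕜 A :=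
  Real.sSup_nonneg (by rintro _ ⟨x, y, -, -, rfl⟩; exact norm_nonneg _)

theorem norm_form_le_mul_normInftyOne (A : Matrix (Fin n) (Fin n) 𝕜) {δ : ℝ} (hδ : 0 < δ)
    {x y : Fin n → 𝕜} (hx : ∀ i, ‖x i‖ ≤ δ) (hy : ∀ i, ‖y i‖ ≤ δ) :
    ‖(n : 𝕜)⁻¹ * ∑ i, star (y i) * A.mulVec x i‖ ≤ δ ^ 2 * normInftyOne 𝕜 A := by
  have hscale (z : Fin n → 𝕜) (hz : ∀ i, ‖z i‖ ≤ δ) (i : Fin n) :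
      ‖(((δ⁻¹ : ℝ) : 𝕜) • z) i‖ ≤ 1 := by
    rw [Pi.smul_apply, norm_smul, RCLike.norm_ofReal, abs_of_pos (inv_pos.2 hδ),
      inv_mul_le_one₀ hδ]
    exact hz i
  have h := le_csSup (bddAbove_normInftyOne A)
    ⟨((δ⁻¹ : ℝ) : 𝕜) • x, ((δ⁻¹ : ℝ) : 𝕜) • y, hscale x hx, hscale y hy, rfl⟩
  have hform : (n : 𝕜)⁻¹ * ∑ i, star ((((δ⁻¹ : ℝ) : 𝕜) • y) i) *
      A.mulVec (((δ⁻¹ : ℝ) : 𝕜) • x) i =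
      (((δ⁻¹) ^ 2 : ℝ) : 𝕜) * ((n : 𝕜)⁻¹ * ∑ i, star (y i) * A.mulVec x i) := by
    simp only [Matrix.mulVec_smul, Pi.smul_apply, smul_eq_mul, star_mul', RCLike.star_def,
      RCLike.conj_ofReal, Finset.mul_sum]
    refine Finset.sum_congr rfl fun i _ => ?_
    push_cast; ring
  rw [hform, norm_mul, RCLike.norm_ofReal, abs_of_nonneg (by positivity), inv_pow,
    inv_mul_le_iff₀ (by positivity)] at h
  exact h

end InftyOne

/-! ### Phase averaging and the operator of a matrix. -/

section Phases

variable {𝕜 : Type} [RCLike 𝕜] {m : ℕ}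

/-- Multiplication of a point of the sphere by a scalar of modulus one. -/
def phase (ζ : 𝕜) (hζ : ‖ζ‖ = 1) (x : USphere 𝕜 m) : USphere 𝕜 m :=
  ⟨ζ • x.1, by
    rw [mem_sphere_zero_iff_norm, norm_smul, hζ, one_mul]; exact mem_sphere_zero_iff_norm.1 x.2⟩

theorem rotate_phase (ζ : 𝕜) (hζ : ‖ζ‖ = 1) (U : UGroup 𝕜 m) (x : USphere 𝕜 m) :
    rotate U (phase ζ hζ x) = phase ζ hζ (rotate U x) := by
  refine Subtype.ext (PiLp.ext fun i => ?_)
  change (U.1.mulVec (ζ • x.1.ofLp)) i = ζ • (U.1.mulVec x.1.ofLp) i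
  rw [Matrix.mulVec_smul]; rfl

variable [NeZero m] {n N : ℕ} {ζ : Fin N → 𝕜}

/-- The operator attached to a matrix `A` and to points `u i`, `v j` of the sphere, projected to
the functions that transform like linear forms under the phases `ζ k`. -/
def matrixOperator (hζ : ∀ k, ‖ζ k‖ = 1) (A : Matrix (Fin n) (Fin n) 𝕜)
    (u v : Fin n → USphere 𝕜 m) :
    C(USphere 𝕜 m × Fin 1, 𝕜) →L[𝕜] C(USphere 𝕜 m × Fin 1, 𝕜) :=
  orbitSum (UGroup 𝕜 m) (I := (Fin n × Fin n) × (Fin N × Fin N))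
    (fun a => (n : 𝕜)⁻¹ * A a.1.1 a.1.2 * ((N : 𝕜)⁻¹ * ζ a.2.1) * ((N : 𝕜)⁻¹ * star (ζ a.2.2)))
    (fun a => (phase (ζ a.2.1) (hζ _) (u a.1.1), 0))
    (fun a => (phase (ζ a.2.2) (hζ _) (v a.1.2), 0))

theorem cutNorm_matrixOperator_le (hζ : ∀ k, ‖ζ k‖ = 1) {δ : ℝ} (hδ : 0 < δ)
    (hζδ : ∀ t : Fin N → ℝ, (∀ k, 0 ≤ t k) → (∀ k, t k ≤ 1) →
      ‖(N : 𝕜)⁻¹ * ∑ k, star (ζ k) * (t k : 𝕜)‖ ≤ δ)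
    (A : Matrix (Fin n) (Fin n) 𝕜) (u v : Fin n → USphere 𝕜 m) :
    cutNorm (sphereProdMeasure 𝕜 m 1) (matrixOperator hζ A u v) ≤
      ENNReal.ofReal (δ ^ 2 * normInftyOne 𝕜 A) := by
  refine cutNorm_orbitSum_le _ _ _ map_smul_haarProb fun f g hf hg U => ?_
  -- The phase sums factor out: the integrand at `U` is the form of `A` at the vectors `P f (v j)`
  -- and `P g (u i)`, whose entries have modulus at most `δ`.
  let P (f : C(USphere 𝕜 m × Fin 1, 𝕜)) (x : USphere 𝕜 m) : 𝕜 :=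
    (N : 𝕜)⁻¹ * ∑ k, star (ζ k) * f (phase (ζ k) (hζ k) (rotate U x), 0)
  have hP (f : C(USphere 𝕜 m × Fin 1, 𝕜)) (hf : UnitIntervalValued f) (x : USphere 𝕜 m) :
      ‖P f x‖ ≤ δ := by
    choose t ht0 ht1 ht using hf
    simp only [P, ht]
    exact hζδ _ (fun k => ht0 _) (fun k => ht1 _)
  refine (le_of_eq ?_).trans (norm_form_le_mul_normInftyOne A hδ (x := fun j => P f (v j))
    (y := fun i => P g (u i)) (fun j => hP f hf _) (fun i => hP g hg _))
  congr 1
  rw [Fintype.sum_prod_type, Fintype.sum_prod_type, Finset.mul_sum]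
  refine Finset.sum_congr rfl fun i _ => ?_
  simp only [Matrix.mulVec, dotProduct, Finset.mul_sum]
  refine Finset.sum_congr rfl fun j _ => ?_
  have hsmul (x : USphere 𝕜 m) (k : Fin N) : U • ((phase (ζ k) (hζ k) x, 0) : _ × Fin 1) =
      (phase (ζ k) (hζ k) (rotate U x), 0) := Prod.ext (rotate_phase _ (hζ k) _ _) rfl
  simp only [P, hsmul, star_mul', star_sum, star_star, Fintype.sum_prod_type, star_inv₀,
    star_natCast]
  have hre (a b α β : 𝕜) (X Y : Fin N → 𝕜) : ∑ k, ∑ l, a * α * X k * (b * β * Y l) =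
      a * (α * ∑ k, X k) * (b * (β * ∑ l, Y l)) := by
    simp only [Finset.mul_sum, Finset.sum_mul]
    rw [Finset.sum_comm]
    exact Finset.sum_congr rfl fun _ _ => Finset.sum_congr rfl fun _ _ => by ring
  have := hre (n : 𝕜)⁻¹ (A i j) (N : 𝕜)⁻¹ (N : 𝕜)⁻¹
    (fun k => ζ k * star (g (phase (ζ k) (hζ k) (rotate U (u i)), 0)))
    (fun l => star (ζ l) * f (phase (ζ l) (hζ l) (rotate U (v j)), 0))
  refine Eq.trans (Finset.sum_congr rfl fun _ _ => Finset.sum_congr rfl fun _ _ => ?_)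
    (this.trans ?_) <;> ring

theorem le_opNormL2_matrixOperator [NeZero N] (hζ : ∀ k, ‖ζ k‖ = 1)
    (A : Matrix (Fin n) (Fin n) 𝕜) (u v : Fin n → USphere 𝕜 m) :
    ENNReal.ofReal ‖(n : 𝕜)⁻¹ * ∑ i, ∑ j, A i j * inner 𝕜 (u i).1 (v j).1‖ ≤
      opNormL2 (sphereProdMeasure 𝕜 m 1) (matrixOperator hζ A u v) := by
  refine le_trans (le_of_eq ?_) (le_opNormL2_orbitSum _ _ _)
  congr 2
  have hN : (N : 𝕜) ≠ 0 := NeZero.ne _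
  simp only [Fintype.sum_prod_type, Finset.mul_sum]
  refine Finset.sum_congr rfl fun i _ => Finset.sum_congr rfl fun j _ => ?_
  have h1 (k : Fin N) : star (ζ k) * ζ k = 1 := by
    rw [RCLike.star_def, RCLike.conj_mul, hζ]; simp
  -- The weights `ζ k` and `star (ζ l)` cancel the phases that come out of the inner product,
  -- leaving `N²` equal terms.
  have h2 (k l : Fin N) : (n : 𝕜)⁻¹ * A i j * ((N : 𝕜)⁻¹ * ζ k) * ((N : 𝕜)⁻¹ * star (ζ l)) *
      inner 𝕜 (phase (ζ k) (hζ k) (u i)).1 (phase (ζ l) (hζ l) (v j)).1 =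
      (N : 𝕜)⁻¹ * (N : 𝕜)⁻¹ * ((n : 𝕜)⁻¹ * (A i j * inner 𝕜 (u i).1 (v j).1)) := by
    have hk := h1 k
    have hl := h1 l
    simp only [phase, inner_smul_left, inner_smul_right, ← RCLike.star_def]
    linear_combination (n : 𝕜)⁻¹ * A i j * (N : 𝕜)⁻¹ * (N : 𝕜)⁻¹ * inner 𝕜 (u i).1 (v j).1 *
      (star (ζ l) * ζ l * hk + hl)
  simp only [h2, Finset.sum_const, Finset.card_univ, Fintype.card_fin, nsmul_eq_mul]
  field_simp

/-- Two extra coordinates complete the norms to 1: one is used only by the `x i`, the other only by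
the `y j`, so neither enters the mixed inner products. -/
theorem exists_sphere_points_inner_eq {d : ℕ} {x y : Fin n → EuclideanSpace 𝕜 (Fin d)}
    (hx : ∀ i, ‖x i‖ ≤ 1) (hy : ∀ i, ‖y i‖ ≤ 1) :
    ∃ u v : Fin n → USphere 𝕜 (d + 2), ∀ i j, inner 𝕜 (u i).1 (v j).1 = inner 𝕜 (x i) (y j) := by
  have hnorm (z : EuclideanSpace 𝕜 (Fin d)) (hz : ‖z‖ ≤ 1) :
      ‖((√(1 - ‖z‖ ^ 2) : ℝ) : 𝕜)‖ ^ 2 + ∑ i, ‖z i‖ ^ 2 = 1 := by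
    rw [← EuclideanSpace.norm_sq_eq, RCLike.norm_ofReal, sq_abs, Real.sq_sqrt, sub_add_cancel]
    nlinarith [norm_nonneg z]
  have hone (z : EuclideanSpace 𝕜 (Fin (d + 2))) (hz : ∑ i, ‖z i‖ ^ 2 = 1) :
      z ∈ Metric.sphere (0 : EuclideanSpace 𝕜 (Fin (d + 2))) 1 := by
    rw [← EuclideanSpace.norm_sq_eq] at hz
    exact mem_sphere_zero_iff_norm.2 ((pow_eq_one_iff_of_nonneg (norm_nonneg _) two_ne_zero).1 hz)
  refine ⟨fun i => ⟨WithLp.toLp 2 (Fin.cons ((√(1 - ‖x i‖ ^ 2) : ℝ) : 𝕜)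
      (Fin.cons 0 (x i).ofLp : Fin (d + 1) → 𝕜)), ?_⟩,
    fun j => ⟨WithLp.toLp 2 (Fin.cons 0
      (Fin.cons ((√(1 - ‖y j‖ ^ 2) : ℝ) : 𝕜) (y j).ofLp : Fin (d + 1) → 𝕜)), ?_⟩, fun i j => ?_⟩
  · exact hone _ (by simpa [Fin.sum_univ_succ] using hnorm (x i) (hx i))
  · exact hone _ (by simpa [Fin.sum_univ_succ] using hnorm (y j) (hy j))
  · simp [PiLp.inner_apply, Fin.sum_univ_succ]

/-- A number below a supremum is exceeded by some member whether or not the set is bounded, so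
Grothendieck's inequality is not needed. -/
theorem exists_matrix_grothendieck_gap (𝕜 : Type) [RCLike 𝕜] (b : ℝ)
    (hb : b < grothendieckConstant 𝕜) :
    ∃ (n d : ℕ) (A : Matrix (Fin n) (Fin n) 𝕜) (x y : Fin n → EuclideanSpace 𝕜 (Fin d)),
      (∀ i, ‖x i‖ ≤ 1) ∧ (∀ i, ‖y i‖ ≤ 1) ∧
      0 < ‖(n : 𝕜)⁻¹ * ∑ i, ∑ j, A i j * inner 𝕜 (x i) (y j)‖ ∧
      b * normInftyOne 𝕜 A ≤ ‖(n : 𝕜)⁻¹ * ∑ i, ∑ j, A i j * inner 𝕜 (x i) (y j)‖ := by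
  rcases lt_or_ge 0 b with hb0 | hb0
  · obtain ⟨_, ⟨n, A, rfl⟩, hA⟩ := exists_lt_of_lt_csSup (by exact ⟨_, 0, 0, rfl⟩) hb
    have hpos : 0 < normInftyOne 𝕜 A := by
      refine (normInftyOne_nonneg A).lt_of_ne fun h => ?_
      rw [← h, div_zero] at hA
      exact hA.not_gt hb0
    rw [lt_div_iff₀ hpos] at hA
    obtain ⟨_, ⟨d, x, y, hx, hy, rfl⟩, hG⟩ := exists_lt_of_lt_csSup
      (by exact ⟨_, 0, 0, 0, by simp, by simp, rfl⟩) hA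
    exact ⟨n, d, A, x, y, hx, hy, (by positivity : 0 ≤ b * normInftyOne 𝕜 A).trans_lt hG, hG.le⟩
  -- For `b ≤ 0` only the strict positivity has content, and the 1 × 1 identity provides it.
  · refine ⟨1, 1, 1, fun _ => EuclideanSpace.single 0 1, fun _ => EuclideanSpace.single 0 1,
      by simp, by simp, by simp, ?_⟩
    exact (mul_nonpos_of_nonpos_of_nonneg hb0 (normInftyOne_nonneg _)).trans (norm_nonneg _)

theorem exists_covariant_of_phases (𝕜 : Type) [RCLike 𝕜] {N : ℕ} [NeZero N] {ζ : Fin N → 𝕜}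
    (hζ : ∀ k, ‖ζ k‖ = 1) {δ : ℝ} (hδ : 0 < δ)
    (hζδ : ∀ t : Fin N → ℝ, (∀ k, 0 ≤ t k) → (∀ k, t k ≤ 1) →
      ‖(N : 𝕜)⁻¹ * ∑ k, star (ζ k) * (t k : 𝕜)‖ ≤ δ)
    {C : ℝ} (hC : C * δ ^ 2 < grothendieckConstant 𝕜) :
    ∃ (m k : ℕ) (_ : NeZero m) (_ : NeZero k)
      (M : C(USphere 𝕜 m × Fin k, 𝕜) →L[𝕜] C(USphere 𝕜 m × Fin k, 𝕜)),
      IsTransitiveCovariant (sphereProdMeasure 𝕜 m k) M ∧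
      cutNorm (sphereProdMeasure 𝕜 m k) M ≠ 0 ∧
      opNormL2 (sphereProdMeasure 𝕜 m k) M ≠ ∞ ∧
      ENNReal.ofReal C * cutNorm (sphereProdMeasure 𝕜 m k) M ≤
        opNormL2 (sphereProdMeasure 𝕜 m k) M := by
  obtain ⟨n, d, A, x, y, hx, hy, hpos, hle⟩ := exists_matrix_grothendieck_gap 𝕜 (C * δ ^ 2) hC
  obtain ⟨u, v, huv⟩ := exists_sphere_points_inner_eq hx hy
  simp only [← huv] at hpos hle
  have hop := le_opNormL2_matrixOperator hζ A u v
  refine ⟨d + 2, 1, inferInstance, inferInstance, matrixOperator hζ A u v,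
    isTransitiveCovariant_orbitSum _ _ _, fun h => ?_,
    opNormL2_orbitSum_ne_top _ _ _ map_smul_haarProb, ?_⟩
  · have : IsFiniteMeasure (sphereProdMeasure 𝕜 (d + 2) 1) := by
      rw [← map_smul_haarProb (basePoint 𝕜 (d + 2), 0)]; infer_instance
    -- A zero cut norm would make the L2 norm zero as well, against its positive lower bound.
    have h0 : opNormL2 (sphereProdMeasure 𝕜 (d + 2) 1) (matrixOperator hζ A u v) = 0 := by
      simp [opNormL2, innerL2_eq_zero_of_cutNorm_eq_zero h]
    rw [h0, nonpos_iff_eq_zero, ENNReal.ofReal_eq_zero] at hop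
    exact hop.not_gt hpos
  · refine le_trans ?_ hop
    rcases le_total C 0 with h | h
    · rw [ENNReal.ofReal_of_nonpos h, zero_mul]; exact zero_le
    refine (mul_le_mul_right (cutNorm_matrixOperator_le hζ hδ hζδ A u v) _).trans ?_
    rw [← ENNReal.ofReal_mul h]
    refine ENNReal.ofReal_le_ofReal ?_
    linarith

end Phases

/-! ### Size of phase averages: signs and roots of unity. -/

section PhaseAverages

variable {𝕜 : Type} [RCLike 𝕜] {N : ℕ}

/-- Rotating the sum by a unimodular `w` makes it real and nonnegative; over weights `t k` in [0,1],
its real part is at most the sum of the positive parts. -/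
theorem norm_phase_average_le {ζ : Fin N → 𝕜} {δ : ℝ}
    (h : ∀ w : 𝕜, ‖w‖ = 1 → (N : ℝ)⁻¹ * ∑ k, max (RCLike.re (w * star (ζ k))) 0 ≤ δ)
    (t : Fin N → ℝ) (ht0 : ∀ k, 0 ≤ t k) (ht1 : ∀ k, t k ≤ 1) :
    ‖(N : 𝕜)⁻¹ * ∑ k, star (ζ k) * (t k : 𝕜)‖ ≤ δ := by
  set S := ∑ k, star (ζ k) * (t k : 𝕜)
  obtain ⟨w, hw, hwS⟩ := RCLike.exists_norm_eq_mul_self S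
  rw [norm_mul, norm_inv, RCLike.norm_natCast]
  refine le_trans ?_ (h w hw)
  gcongr
  have hre : ‖S‖ = RCLike.re (w * S) := by rw [← hwS, RCLike.ofReal_re]
  rw [hre, Finset.mul_sum, map_sum]
  refine Finset.sum_le_sum fun k _ => ?_
  rw [← mul_assoc, mul_comm _ (t k : 𝕜), RCLike.re_ofReal_mul]
  calc _ ≤ t k * max (RCLike.re (w * star (ζ k))) 0 := by
        gcongr
        · exact ht0 k
        · exact le_max_left _ _
    _ ≤ _ := mul_le_of_le_one_left (le_max_right _ _) (ht1 k)

theorem real_phase_average (w : ℝ) (hw : ‖w‖ = 1) :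
    ((2 : ℕ) : ℝ)⁻¹ * ∑ k, max (RCLike.re (w * star ((![1, -1] : Fin 2 → ℝ) k))) 0 ≤ 1 / 2 := by
  rcases (abs_eq zero_le_one).1 hw with rfl | rfl <;> simp

open Real in
theorem integral_max_cos_zero (a : ℝ) : ∫ x in a..a + 2 * π, max (cos x) 0 = 2 := by
  have hper : Function.Periodic (fun x : ℝ => max (cos x) 0) (2 * π) := fun x => by
    simp only [cos_add_two_pi]
  have hc : Continuous fun x : ℝ => max (cos x) 0 := by fun_prop
  -- The period is moved to start at `-π/2`, so that cosine is nonnegative on the first half and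
  -- nonpositive on the second.
  rw [hper.intervalIntegral_add_eq a (-(π / 2)),
    ← intervalIntegral.integral_add_adjacent_intervals (b := π / 2)
      (hc.intervalIntegrable _ _) (hc.intervalIntegrable _ _)]
  have h1 : ∫ x in -(π / 2)..π / 2, max (cos x) 0 = ∫ x in -(π / 2)..π / 2, cos x := by
    refine intervalIntegral.integral_congr fun x hx => ?_
    rw [Set.uIcc_of_le (by linarith [pi_pos])] at hx
    exact max_eq_left (cos_nonneg_of_mem_Icc hx)
  have h2 : ∫ x in π / 2..-(π / 2) + 2 * π, max (cos x) 0 =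
      ∫ x in π / 2..-(π / 2) + 2 * π, (0 : ℝ) := by
    refine intervalIntegral.integral_congr fun x hx => ?_
    rw [Set.uIcc_of_le (by linarith [pi_pos])] at hx
    exact max_eq_right (cos_nonpos_of_pi_div_two_le_of_le hx.1 (by linarith [hx.2]))
  rw [h1, h2, integral_cos, sin_neg, sin_pi_div_two]
  norm_num

open Real in
-- This is a Riemann sum of mesh `s = 2π/N`. Cosine is 1-Lipschitz, so each cell costs at most `s²`;
-- the total `2 + 2πs`, divided by `2π`, is `1/π + s`.
theorem average_max_cos_le (N : ℕ) [NeZero N] (φ : ℝ) :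
    (N : ℝ)⁻¹ * ∑ k ∈ Finset.range N, max (cos (φ + k * (2 * π / N))) 0 ≤ π⁻¹ + 2 * π / N := by
  have hN : (0 : ℝ) < N := Nat.cast_pos.2 (NeZero.pos N)
  set s := 2 * π / N with hs
  have hs0 : 0 < s := by positivity
  have hc : Continuous fun x : ℝ => max (cos x) 0 := by fun_prop
  have hstep (k : ℕ) : s * max (cos (φ + k * s)) 0 ≤
      (∫ x in φ + k * s..φ + (k + 1 : ℕ) * s, max (cos x) 0) + s * s := by
    have hle : φ + k * s ≤ φ + (k + 1 : ℕ) * s := by push_cast; nlinarith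
    have hlen : φ + (k + 1 : ℕ) * s - (φ + k * s) = s := by push_cast; ring
    have h1 : ∫ x in φ + k * s..φ + (k + 1 : ℕ) * s, (max (cos (φ + k * s)) 0 - s) ≤
        ∫ x in φ + k * s..φ + (k + 1 : ℕ) * s, max (cos x) 0 := by
      refine intervalIntegral.integral_mono_on hle (by simp) (hc.intervalIntegrable _ _)
        fun x hx => ?_
      have hlip : |cos (φ + k * s) - cos x| ≤ |φ + k * s - x| := abs_cos_sub_cos_le _ _
      have habs : |φ + k * s - x| ≤ s := abs_le.2 ⟨by linarith [hx.2], by linarith [hx.1]⟩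
      rcases max_cases (cos (φ + k * s)) 0 with ⟨h, -⟩ | ⟨h, -⟩ <;> rw [h]
      · linarith [le_max_left (cos x) 0, (abs_le.1 (hlip.trans habs)).2]
      · linarith [le_max_right (cos x) 0]
    rw [intervalIntegral.integral_const, hlen, smul_eq_mul, mul_sub] at h1
    linarith
  have hsum := Finset.sum_le_sum fun k (_ : k ∈ Finset.range N) => hstep k
  rw [← Finset.mul_sum, Finset.sum_add_distrib,
    intervalIntegral.sum_integral_adjacent_intervals (a := fun k : ℕ => φ + k * s)
      fun k _ => hc.intervalIntegrable _ _] at hsum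
  have hNs : N * s = 2 * π := by rw [hs]; field_simp
  simp only [Nat.cast_zero, zero_mul, add_zero, hNs, integral_max_cos_zero, Finset.sum_const,
    Finset.card_range, nsmul_eq_mul] at hsum
  rw [← mul_assoc, hNs] at hsum
  have hNinv : (N : ℝ)⁻¹ = s / (2 * π) := by rw [← hNs]; field_simp
  rw [hNinv, div_mul_eq_mul_div, div_le_iff₀ (by positivity)]
  refine hsum.trans (le_of_eq ?_)
  field_simp

open Complex in
theorem complex_phase_average [NeZero N] (w : ℂ) (hw : ‖w‖ = 1) :
    (N : ℝ)⁻¹ * ∑ k : Fin N,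
      max (RCLike.re (w * star (exp (-(((k : ℕ) * (2 * Real.pi / N) : ℝ) * I))))) 0 ≤
        Real.pi⁻¹ + 2 * Real.pi / N := by
  refine le_trans (le_of_eq ?_) (average_max_cos_le N (arg w))
  rw [← Fin.sum_univ_eq_sum_range (fun k => max (Real.cos (arg w + k * (2 * Real.pi / N))) 0)]
  congr 1
  refine Finset.sum_congr rfl fun k _ => ?_
  congr 1
  have h1 : w = exp (arg w * I) := by
    -- With the minus sign in `ζ k`, conjugation adds the angle `2πk/N` to `arg w`.
    conv_lhs => rw [← norm_mul_exp_arg_mul_I w, hw, ofReal_one, one_mul]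
  conv_lhs => rw [h1]
  rw [RCLike.star_def, ← exp_conj, ← exp_add, map_neg, map_mul, conj_I, conj_ofReal, mul_neg,
    neg_neg, ← add_mul, ← ofReal_add]
  exact exp_ofReal_mul_I_re _

end PhaseAverages

theorem exists_covariant_complex {C : ℝ} (hC : C < Real.pi ^ 2 * grothendieckConstant ℂ) :
    ∃ (m k : ℕ) (_ : NeZero m) (_ : NeZero k)
      (M : C(USphere ℂ m × Fin k, ℂ) →L[ℂ] C(USphere ℂ m × Fin k, ℂ)),
      IsTransitiveCovariant (sphereProdMeasure ℂ m k) M ∧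
      cutNorm (sphereProdMeasure ℂ m k) M ≠ 0 ∧
      opNormL2 (sphereProdMeasure ℂ m k) M ≠ ∞ ∧
      ENNReal.ofReal C * cutNorm (sphereProdMeasure ℂ m k) M ≤
        opNormL2 (sphereProdMeasure ℂ m k) M := by
  -- The hypothesis on `C` is strict, so it survives replacing `1/π` by the bound for finitely many
  -- roots of unity; `N + 1` keeps their number nonzero.
  have hlim : Filter.Tendsto (fun N : ℕ => C * (Real.pi⁻¹ + 2 * Real.pi / (N + 1 : ℕ)) ^ 2)
      Filter.atTop (nhds (C * (Real.pi⁻¹ + 0) ^ 2)) :=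
    ((tendsto_const_nhds.add ((Filter.tendsto_add_atTop_iff_nat 1).2
      (tendsto_const_div_atTop_nhds_zero_nat (2 * Real.pi)))).pow 2).const_mul C
  have hlt : C * (Real.pi⁻¹ + 0) ^ 2 < grothendieckConstant ℂ := by
    rw [add_zero, inv_pow, ← div_eq_mul_inv, div_lt_iff₀ (by positivity), mul_comm]
    exact hC
  obtain ⟨N, hN⟩ := (hlim.eventually_lt_const hlt).exists
  refine exists_covariant_of_phases ℂ (fun k => ?_) (by positivity)
    (norm_phase_average_le (complex_phase_average (N := N + 1))) hN
  rw [← neg_mul, ← Complex.ofReal_neg]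
  exact Complex.norm_exp_ofReal_mul_I _

theorem exists_covariant_real {C : ℝ} (hC : C < 4 * grothendieckConstant ℝ) :
    ∃ (m k : ℕ) (_ : NeZero m) (_ : NeZero k)
      (M : C(USphere ℝ m × Fin k, ℝ) →L[ℝ] C(USphere ℝ m × Fin k, ℝ)),
      IsTransitiveCovariant (sphereProdMeasure ℝ m k) M ∧
      cutNorm (sphereProdMeasure ℝ m k) M ≠ 0 ∧
      opNormL2 (sphereProdMeasure ℝ m k) M ≠ ∞ ∧
      ENNReal.ofReal C * cutNorm (sphereProdMeasure ℝ m k) M ≤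
        opNormL2 (sphereProdMeasure ℝ m k) M := by
  refine exists_covariant_of_phases ℝ (ζ := ![1, -1]) (fun k => ?_) one_half_pos
    (norm_phase_average_le real_phase_average) (by linarith)
  fin_cases k <;> simp

end

end CutNorm

theorem theorem4p1 :
    (∀ ε : ℝ, 0 < ε → ∃ (m k : ℕ) (_ : NeZero m) (_ : NeZero k)
      (M : C(CutNorm.USphere ℂ m × Fin k, ℂ) →L[ℂ] C(CutNorm.USphere ℂ m × Fin k, ℂ)),
      CutNorm.IsTransitiveCovariant (CutNorm.sphereProdMeasure ℂ m k) M ∧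
      CutNorm.cutNorm (CutNorm.sphereProdMeasure ℂ m k) M ≠ 0 ∧
      CutNorm.opNormL2 (CutNorm.sphereProdMeasure ℂ m k) M ≠ ∞ ∧
      ENNReal.ofReal (Real.pi ^ 2 * CutNorm.grothendieckConstant ℂ - ε) *
          CutNorm.cutNorm (CutNorm.sphereProdMeasure ℂ m k) M ≤
        CutNorm.opNormL2 (CutNorm.sphereProdMeasure ℂ m k) M) ∧
    (∀ ε : ℝ, 0 < ε → ∃ (m k : ℕ) (_ : NeZero m) (_ : NeZero k)
      (M : C(CutNorm.USphere ℝ m × Fin k, ℝ) →L[ℝ] C(CutNorm.USphere ℝ m × Fin k, ℝ)),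
      CutNorm.IsTransitiveCovariant (CutNorm.sphereProdMeasure ℝ m k) M ∧
      CutNorm.cutNorm (CutNorm.sphereProdMeasure ℝ m k) M ≠ 0 ∧
      CutNorm.opNormL2 (CutNorm.sphereProdMeasure ℝ m k) M ≠ ∞ ∧
      ENNReal.ofReal (4 * CutNorm.grothendieckConstant ℝ - ε) *
          CutNorm.cutNorm (CutNorm.sphereProdMeasure ℝ m k) M ≤
        CutNorm.opNormL2 (CutNorm.sphereProdMeasure ℝ m k) M) :=
  ⟨fun _ hε => CutNorm.exists_covariant_complex (sub_lt_self _ hε),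
    fun _ hε => CutNorm.exists_covariant_real (sub_lt_self _ hε)⟩
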